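/- **Definitions.** A map $f:X\to Y$ between topological spaces is *Darboux* if $f(C)$ is connected for every connected $C\subseteq X$; a *Darboux injection* is an injective Darboux map. A subset $S$ of a topological space *separates* a subset $A$ if $A\setminus S$ is disconnected, i.e. is the union of two disjoint nonempty relatively open subsets. A *fence* is a compact Hausdorff space (possibly empty) each of whose connected components is homeomorphic to a segment $[a,b]\subset\mathbb R$ with $a\le b$ (that is, to an arc or a point). A topological space is *componnected* if its topology has a base $\mathcal B$ such that for every $B\in\mathcal B$ the complement of $B$ is a finite union $C_1\cup\dots\cup C_n$ of sets each of which is compact or connected. The $n$-varieties, $n\ge 1$, are defined inductively. A *$1$-variety* is a Hausdorff space each of whose points has a neighborhood homeomorphic to $\mathbb R$. For $n\ge 1$, an *$(n+1)$-variety* is a first-countable Hausdorff space $Y$ such that every connected component of $Y$ is componnected and, for every connected set $C\subseteq Y$ containing more than one point and every sequence $(y_k)_{k\in\mathbb N}$ in $Y$ converging to a point of $\overline C$, there is a compact connected subspace $S\subseteq Y$ which is an $n$-variety, separates $C$, and satisfies $y_k\in S$ for infinitely many indices $k$. **Theorem.** Let $X$ be a compact Hausdorff space with more than one point such that no subspace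 $F\subseteq X$ that is a fence separates $X$. Then every Darboux injection $f:X\to Y$ into a $2$-variety $Y$ is an open topological embedding, i.e. a homeomorphism onto an open subspace of $Y$. -/

import Mathlib

universe u

/-- A map is Darboux if it sends connected subsets to connected subsets. -/
def IsDarboux {X Y : Type*} [TopologicalSpace X] [TopologicalSpace Y] (f : X → Y) : Prop :=
  ∀ C : Set X, IsConnected C → IsConnected (f '' C)

/-- The set `S` separates the set `A` if `A \ S` is disconnected, that is, it is the union of two
disjoint nonempty relatively open subsets (so the empty set is not disconnected). -/
def Separates {X : Type*} [TopologicalSpace X] (S A : Set X) : Prop :=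
  ¬ IsPreconnected (A \ S)

/-- A fence: a compact Hausdorff space all of whose connected components are homeomorphic to
segments `[a, b]` of the real line with `a ≤ b`, i.e. are arcs or points. The empty space is a
fence. -/
def IsFence (F : Type*) [TopologicalSpace F] : Prop :=
  CompactSpace F ∧ T2Space F ∧
    ∀ x : F, ∃ a b : ℝ, a ≤ b ∧ Nonempty (connectedComponent x ≃ₜ Set.Icc a b)

/-- A space is componnected if it has a base such that the complement of every element of the base
is a finite union of sets each of which is compact or connected. -/
def IsComponnected (X : Type*) [TopologicalSpace X] : Prop :=
  ∃ B : Set (Set X), TopologicalSpace.IsTopologicalBasis B ∧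
    ∀ U ∈ B, ∃ F : Set (Set X), F.Finite ∧ (∀ C ∈ F, IsCompact C ∨ IsConnected C) ∧ Uᶜ = ⋃₀ F

/-- `IsVariety n Y` says that `Y` is an `n`-variety, where `n ≥ 1` (there are no `0`-varieties).
Subsets of `Y` carry the subspace topology. -/
def IsVariety : ℕ → ∀ (Y : Type u) [TopologicalSpace Y], Prop
  | 0, _, _ => False
  | 1, Y, _ => T2Space Y ∧ ∀ y : Y, ∃ N ∈ nhds y, Nonempty (N ≃ₜ ℝ)
  | n + 2, Y, _ =>
      T2Space Y ∧ FirstCountableTopology Y ∧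
      (∀ y : Y, IsComponnected (connectedComponent y)) ∧
      ∀ C : Set Y, IsConnected C → C.Nontrivial →
        ∀ (s : ℕ → Y) (y : Y), Filter.Tendsto s Filter.atTop (nhds y) → y ∈ closure C →
          ∃ S : Set Y, IsCompact S ∧ IsConnected S ∧ IsVariety (n + 1) S ∧
            Separates S C ∧ {k : ℕ | s k ∈ S}.Infinite

open Set Topology

/-! Every compact connected 1-manifold `S` that separates `range f` is the image of a compact `K` on
which `f` is continuous (`IsDarboux.exists_continuousOn_image_eq`). Given this, sequences through
such `S` show that `range f` is closed and open and that `f` is a closed map. So `range f` is a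
component of `Y`, hence componnected, and `IsDarboux.continuous_of_isClosedMap` makes `f`
continuous.

To find `K`, consider a component `D` of a closed set inside `A = f ⁻¹' S`. If `f` maps `D` onto
`S`, it is continuous there and `D` serves as `K`. If not, `f '' D` lies in an open arc, a Darboux
injection into the line is continuous, and `D` is a segment. So without `K`, every closed subset of
`A` is a fence and cannot separate `X`. But `A` itself separates `X`, and then so does some closed
subset of it. -/

/-! ### Open arcs in one-dimensional manifolds. -/

/-- A path that leaves an open arc runs out along one of its ends. If it missed a point of the arc
on each side of `h s`, the open subarc between them and the complement of the closed subarc would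
split it. -/
lemma arc_exit {S : Type*} [TopologicalSpace S] [T2Space S] {e h : ℝ → S} (he : Continuous e)
    (hh : IsOpenEmbedding h) {t s b : ℝ} (hts : e t = h s) (hb : e b ∉ range h) :
    (∀ s' ≥ s, h s' ∈ e '' uIcc t b) ∨ (∀ s' ≤ s, h s' ∈ e '' uIcc t b) := by
  by_contra! H
  obtain ⟨⟨s₁, hs₁, h₁⟩, s₂, hs₂, h₂⟩ := H
  have key : ∀ u ∈ uIcc t b, ∀ v, e u = h v → v ≠ s₁ ∧ v ≠ s₂ := by
    rintro u hu v huv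
    exact ⟨fun hv => h₁ ⟨u, hu, by rw [huv, hv]⟩, fun hv => h₂ ⟨u, hu, by rw [huv, hv]⟩⟩
  have hO₁ : IsOpen (e ⁻¹' (h '' Ioo s₂ s₁)) := (hh.isOpenMap _ isOpen_Ioo).preimage he
  have hO₂ : IsOpen (e ⁻¹' (h '' Icc s₂ s₁)ᶜ) :=
    ((isCompact_Icc.image hh.continuous).isClosed.isOpen_compl).preimage he
  have hst := key t left_mem_uIcc s hts
  obtain ⟨u, -, ⟨v, hv, hvu⟩, hu⟩ := (isPreconnected_uIcc (a := t) (b := b)) _ _ hO₁ hO₂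
    (by
      intro u hu
      by_cases hc : e u ∈ h '' Icc s₂ s₁
      · obtain ⟨v, hv, hvu⟩ := hc
        have := key u hu v hvu.symm
        exact Or.inl ⟨v, ⟨lt_of_le_of_ne hv.1 this.2.symm, lt_of_le_of_ne hv.2 this.1⟩, hvu⟩
      · exact Or.inr hc)
    ⟨t, left_mem_uIcc, s, ⟨lt_of_le_of_ne hs₂ hst.2.symm, lt_of_le_of_ne hs₁ hst.1⟩, hts.symm⟩
    ⟨b, right_mem_uIcc, fun ⟨v, _, hv⟩ => hb ⟨v, hv⟩⟩
  exact hu ⟨v, Ioo_subset_Icc_self hv, hvu⟩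

/-- In a chart, `g` is locally a continuous injection between intervals, hence strictly monotone,
and its image is a neighborhood by the intermediate value theorem. -/
lemma isOpenEmbedding_of_charts {S : Type*} [TopologicalSpace S] {g : ℝ → S} (hg : Continuous g)
    (hinj : Function.Injective g)
    (hch : ∀ t, ∃ e : ℝ → S, IsOpenEmbedding e ∧ g t ∈ range e) : IsOpenEmbedding g := by
  refine .of_continuous_injective_isOpenMap hg hinj ?_
  rw [isOpenMap_iff_nhds_le]
  intro t A hA
  rw [Filter.mem_map] at hA
  obtain ⟨e, he, r, hr⟩ := hch t
  have hO : g ⁻¹' range e ∈ 𝓝 t := (he.isOpen_range.preimage hg).mem_nhds ⟨r, hr⟩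
  obtain ⟨δ, hδ, hsub⟩ := Metric.nhds_basis_closedBall.mem_iff.1 (Filter.inter_mem hA hO)
  rw [Real.closedBall_eq_Icc] at hsub
  set k : ℝ → ℝ := Function.invFun e ∘ g
  have hek : ∀ u ∈ Icc (t - δ) (t + δ), e (k u) = g u := fun u hu =>
    Function.invFun_eq (hsub hu).2
  have hkc : ContinuousOn k (Icc (t - δ) (t + δ)) := by
    rw [he.isInducing.continuousOn_iff]
    exact hg.continuousOn.congr hek
  have hki : InjOn k (Icc (t - δ) (t + δ)) := by
    intro u hu v hv huv
    exact hinj (by rw [← hek u hu, ← hek v hv, huv])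
  have hl : t - δ ∈ Icc (t - δ) (t + δ) := ⟨le_rfl, by linarith⟩
  have hm : t ∈ Icc (t - δ) (t + δ) := ⟨by linarith, by linarith⟩
  have hu : t + δ ∈ Icc (t - δ) (t + δ) := ⟨by linarith, le_rfl⟩
  have hle : t - δ ≤ t + δ := by linarith
  have hmem : k '' Icc (t - δ) (t + δ) ∈ 𝓝 (k t) := by
    rcases hkc.strictMonoOn_of_injOn_Icc' hle hki with hmono | hanti
    · exact Filter.mem_of_superset (Icc_mem_nhds (hmono hl hm (by linarith))
        (hmono hm hu (by linarith))) (intermediate_value_Icc hle hkc)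
    · exact Filter.mem_of_superset (Icc_mem_nhds (hanti hm hu (by linarith))
        (hanti hl hm (by linarith))) (intermediate_value_Icc' hle hkc)
  have := he.isOpenMap.image_mem_nhds hmem
  rw [hek t hm] at this
  refine Filter.mem_of_superset this ?_
  rintro _ ⟨_, ⟨u, hu, rfl⟩, rfl⟩
  rw [hek u hu]
  exact (hsub hu).1

/-- The upper end of `h` is swallowed by `e` and the lower end of `e` by `h`, so following `h` up to
the common point and then `e` traverses the whole union. -/
lemma exists_arc_union_of_ends {S : Type*} [TopologicalSpace S] [T2Space S] {e h : ℝ → S}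
    (he : IsOpenEmbedding e) (hh : IsOpenEmbedding h) {t₀ s₀ b c : ℝ} (hts : e t₀ = h s₀)
    (hb : e b ∉ range h) (hc : h c ∉ range e) {K₁ K₂ : Set S} (hK₁ : IsCompact K₁)
    (hK₂ : IsCompact K₂) (hK₁e : K₁ ⊆ range e) (hK₂h : K₂ ⊆ range h)
    (H₁ : ∀ s ≥ s₀, h s ∈ K₁) (H₂ : ∀ t ≤ t₀, e t ∈ K₂)
    (hnc : ¬ IsCompact (range e ∪ range h)) :
    ∃ g : ℝ → S, IsOpenEmbedding g ∧ range g = range e ∪ range h := by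
  have hbt : t₀ < b := by
    by_contra! hle
    exact hb (hK₂h (H₂ b hle))
  have hcs : c < s₀ := by
    by_contra! hle
    exact hc (hK₁e (H₁ c hle))
  let g : ℝ → S := fun u => if u ≤ 0 then h (s₀ + u) else e (t₀ + u)
  have hgl : ∀ u ≤ 0, g u = h (s₀ + u) := fun u hu => if_pos hu
  have hgr : ∀ u, 0 ≤ u → g u = e (t₀ + u) := by
    intro u hu
    rcases hu.eq_or_lt with rfl | hu
    · rw [hgl 0 le_rfl, add_zero, add_zero, hts]
    · exact if_neg (not_le.2 hu)
  have hgc : Continuous g := by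
    refine Continuous.if_le (hh.continuous.comp (by fun_prop)) (he.continuous.comp (by fun_prop))
      continuous_id continuous_const ?_
    rintro x rfl
    simpa using hts.symm
  have hrange : range g = range e ∪ range h := by
    apply Subset.antisymm
    · rintro _ ⟨u, rfl⟩
      rcases le_total u 0 with hu | hu
      · exact Or.inr ⟨_, (hgl u hu).symm⟩
      · exact Or.inl ⟨_, (hgr u hu).symm⟩
    · have hl : ∀ s ≤ s₀, h s ∈ range g := fun s hs =>
        ⟨s - s₀, by rw [hgl _ (by linarith), add_sub_cancel]⟩
      have hr : ∀ t ≥ t₀, e t ∈ range g := fun t ht =>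
        ⟨t - t₀, by rw [hgr _ (by linarith), add_sub_cancel]⟩
      obtain hE := (arc_exit he.continuous hh hts hb).resolve_right
        fun H => hc ((image_subset_range _ _) (H c hcs.le))
      obtain hF := (arc_exit hh.continuous he hts.symm hc).resolve_left
        fun H => hb ((image_subset_range _ _) (H b hbt.le))
      rintro _ (⟨t, rfl⟩ | ⟨s, rfl⟩)
      · rcases le_total t₀ t with ht | ht
        · exact hr t ht
        · obtain ⟨s, hs, hst⟩ := hF t ht
          rw [uIcc_of_ge hcs.le] at hs
          exact hst ▸ hl s hs.2
      · rcases le_total s s₀ with hs | hs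
        · exact hl s hs
        · obtain ⟨t, ht, hst⟩ := hE s hs
          rw [uIcc_of_le hbt.le] at ht
          exact hst ▸ hr t ht.1
  -- A second crossing would trap the two remaining ends as well, closing the union up into a
  -- compact set.
  have hcross : ∀ s t, s ≤ s₀ → t₀ < t → h s ≠ e t := by
    intro s t hs ht hst
    have hs : s < s₀ := by
      refine lt_of_le_of_ne hs ?_
      rintro rfl
      exact ht.ne (he.injective (hts.trans hst))
    have hE := (arc_exit he.continuous hh hst.symm hb).resolve_left fun H => by
      obtain ⟨t', ht', h'⟩ := H s₀ hs.le
      have : t' = t₀ := he.injective (h'.trans hts.symm)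
      subst this
      exact absurd ht'.1 (not_le.2 (lt_min ht hbt))
    have hF := (arc_exit hh.continuous he hst hc).resolve_right fun H => by
      obtain ⟨s', hs', h'⟩ := H t₀ ht.le
      have : s' = s₀ := hh.injective (h'.trans hts)
      subst this
      exact absurd hs'.2 (not_le.2 (max_lt hs hcs))
    apply hnc
    have hC : IsCompact (e '' uIcc t b ∪ h '' uIcc s c ∪ (K₁ ∪ K₂) ∪
        (e '' Icc t₀ t ∪ h '' Icc s s₀)) :=
      (((isCompact_uIcc.image he.continuous).union (isCompact_uIcc.image hh.continuous)).union
        (hK₁.union hK₂)).union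
        ((isCompact_Icc.image he.continuous).union (isCompact_Icc.image hh.continuous))
    convert hC using 1
    apply Subset.antisymm
    · rintro _ (⟨x, rfl⟩ | ⟨x, rfl⟩)
      · rcases le_total x t₀ with hx | hx
        · exact Or.inl (Or.inr (Or.inr (H₂ x hx)))
        · rcases le_total x t with hx' | hx'
          · exact Or.inr (Or.inl ⟨x, ⟨hx, hx'⟩, rfl⟩)
          · exact Or.inl (Or.inl (Or.inr (hF x hx')))
      · rcases le_total s₀ x with hx | hx
        · exact Or.inl (Or.inr (Or.inl (H₁ x hx)))
        · rcases le_total s x with hx' | hx'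
          · exact Or.inr (Or.inr ⟨x, ⟨hx', hx⟩, rfl⟩)
          · exact Or.inl (Or.inl (Or.inl (hE x hx')))
    · rintro x (((hx | hx) | (hx | hx)) | (hx | hx))
      · exact Or.inl (image_subset_range _ _ hx)
      · exact Or.inr (image_subset_range _ _ hx)
      · exact Or.inl (hK₁e hx)
      · exact Or.inr (hK₂h hx)
      · exact Or.inl (image_subset_range _ _ hx)
      · exact Or.inr (image_subset_range _ _ hx)
  refine ⟨g, isOpenEmbedding_of_charts hgc ?_ fun t => ?_, hrange⟩
  · intro u v huv
    rcases le_or_gt u 0 with hu | hu <;> rcases le_or_gt v 0 with hv | hv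
    · rw [hgl u hu, hgl v hv] at huv
      exact add_left_cancel (hh.injective huv)
    · rw [hgl u hu, hgr v hv.le] at huv
      exact absurd huv (hcross _ _ (by linarith) (by linarith))
    · rw [hgr u hu.le, hgl v hv] at huv
      exact absurd huv.symm (hcross _ _ (by linarith) (by linarith))
    · rw [hgr u hu.le, hgr v hv.le] at huv
      exact add_left_cancel (he.injective huv)
  · rcases (hrange ▸ mem_range_self t : g t ∈ range e ∪ range h) with H | H
    · exact ⟨e, he, H⟩
    · exact ⟨h, hh, H⟩

/-- The union of two open arcs with a common point is an open arc, unless it is compact. -/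
lemma exists_arc_union {S : Type*} [TopologicalSpace S] [T2Space S] {e h : ℝ → S}
    (he : IsOpenEmbedding e) (hh : IsOpenEmbedding h) (hne : (range e ∩ range h).Nonempty)
    (hnc : ¬ IsCompact (range e ∪ range h)) :
    ∃ g : ℝ → S, IsOpenEmbedding g ∧ range g = range e ∪ range h := by
  by_cases hb : range e ⊆ range h
  · exact ⟨h, hh, (union_eq_right.2 hb).symm⟩
  by_cases hc : range h ⊆ range e
  · exact ⟨e, he, (union_eq_left.2 hc).symm⟩
  obtain ⟨_, ⟨b, rfl⟩, hb⟩ := not_subset.1 hb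
  obtain ⟨_, ⟨c, rfl⟩, hc⟩ := not_subset.1 hc
  obtain ⟨_, ⟨t, rfl⟩, s, hts⟩ := hne
  have hE := arc_exit he.continuous hh hts.symm hb
  have hF := arc_exit hh.continuous he hts hc
  have hKe : IsCompact (e '' uIcc t b) := isCompact_uIcc.image he.continuous
  have hKh : IsCompact (h '' uIcc s c) := isCompact_uIcc.image hh.continuous
  have hneg : IsOpenEmbedding (fun x : ℝ => -x) := (Homeomorph.neg ℝ).isOpenEmbedding
  have he' := he.comp hneg
  have hh' := hh.comp hneg
  have re : range (e ∘ fun x => -x) = range e := neg_surjective.range_comp e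
  have rh : range (h ∘ fun x => -x) = range h := neg_surjective.range_comp h
  have se := image_subset_range e (uIcc t b)
  have sh := image_subset_range h (uIcc s c)
  -- Reversing `e` or `h` where needed brings each case to the one with the upper end of `h` and the
  -- lower end of `e` trapped.
  rcases hE with hE | hE <;> rcases hF with hF | hF
  · rw [← re] at hnc se hc ⊢
    exact exists_arc_union_of_ends he' hh (t₀ := -t) (s₀ := s) (b := -b) (c := c)
      (by simp [hts]) (by simpa using hb) hc hKe hKh se sh hE
      (fun x hx => hF (-x) (by linarith)) hnc
  · exact exists_arc_union_of_ends he hh hts.symm hb hc hKe hKh se sh hE hF hnc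
  · rw [← re] at hnc se hc ⊢
    rw [← rh] at hnc sh hb ⊢
    exact exists_arc_union_of_ends he' hh' (t₀ := -t) (s₀ := -s) (b := -b) (c := -c)
      (by simp [hts]) (by simpa using hb) (by simpa using hc) hKe hKh se sh
      (fun x hx => hE (-x) (by linarith)) (fun x hx => hF (-x) (by linarith)) hnc
  · rw [← rh] at hnc sh hb ⊢
    exact exists_arc_union_of_ends he hh' (t₀ := t) (s₀ := -s) (b := b) (c := -c)
      (by simp [hts]) hb (by simpa using hc) hKe hKh se sh
      (fun x hx => hE (-x) (by linarith)) hF hnc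

/-- Every open neighborhood of a point with a neighborhood homeomorphic to the line contains an
open arc through this point. -/
lemma exists_arc_subset {S : Type*} [TopologicalSpace S] {y : S}
    (hy : ∃ N ∈ 𝓝 y, Nonempty (N ≃ₜ ℝ)) {O : Set S} (hO : O ∈ 𝓝 y) :
    ∃ e : ℝ → S, IsOpenEmbedding e ∧ range e ⊆ O ∧ y ∈ range e := by
  obtain ⟨N, hN, ⟨φ⟩⟩ := hy
  let ψ : ℝ → S := Subtype.val ∘ φ.symm
  have hψ : IsEmbedding ψ := IsEmbedding.subtypeVal.comp φ.symm.isEmbedding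
  have hyN : y ∈ N := mem_of_mem_nhds hN
  have hψy : ψ (φ ⟨y, hyN⟩) = y := by simp [ψ]
  have hnb : ψ ⁻¹' (interior N ∩ O) ∈ 𝓝 (φ ⟨y, hyN⟩) := by
    apply hψ.continuous.continuousAt
    rw [hψy]
    exact Filter.inter_mem (interior_mem_nhds.2 hN) hO
  obtain ⟨ε, hε, hsub⟩ := Metric.mem_nhds_iff.1 hnb
  have hu : IsOpenEmbedding (OpenPartialHomeomorph.univBall (E := ℝ) (φ ⟨y, hyN⟩) ε) :=
    OpenPartialHomeomorph.isOpenEmbedding _ (OpenPartialHomeomorph.univBall_source _ _)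
  have hur : range (OpenPartialHomeomorph.univBall (E := ℝ) (φ ⟨y, hyN⟩) ε)
      = Metric.ball (φ ⟨y, hyN⟩) ε := by
    rw [← OpenPartialHomeomorph.univBall_target _ hε, ← image_univ,
      ← OpenPartialHomeomorph.univBall_source (φ ⟨y, hyN⟩) ε,
      OpenPartialHomeomorph.image_source_eq_target]
  have hr : range (ψ ∘ OpenPartialHomeomorph.univBall (E := ℝ) (φ ⟨y, hyN⟩) ε)
      = ψ '' Metric.ball (φ ⟨y, hyN⟩) ε := by rw [range_comp, hur]
  refine ⟨ψ ∘ OpenPartialHomeomorph.univBall (E := ℝ) (φ ⟨y, hyN⟩) ε,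
    ⟨hψ.comp hu.isEmbedding, ?_⟩, ?_, ?_⟩
  · rw [hr]
    obtain ⟨G, hG, hGe⟩ := hψ.isInducing.isOpen_iff.1
      (Metric.isOpen_ball (x := φ ⟨y, hyN⟩) (ε := ε))
    convert (isOpen_interior (s := N)).inter hG using 1
    apply Subset.antisymm
    · rintro _ ⟨t, ht, rfl⟩
      exact ⟨(hsub ht).1, (hGe.symm ▸ ht : t ∈ ψ ⁻¹' G)⟩
    · rintro z ⟨hzN, hzG⟩
      have hz : ψ (φ ⟨z, interior_subset hzN⟩) = z := by simp [ψ]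
      refine ⟨φ ⟨z, interior_subset hzN⟩, ?_, hz⟩
      rw [← hGe, mem_preimage, hz]
      exact hzG
  · rw [hr]
    rintro _ ⟨t, ht, rfl⟩
    exact (hsub ht).2
  · rw [hr]
    exact ⟨_, Metric.mem_ball_self hε, hψy⟩

/-- In a connected one-dimensional manifold, two open arcs that meet and avoid a common point have
an open arc for union. -/
lemma exists_arc_union_avoiding {S : Type*} [TopologicalSpace S] [T2Space S] [PreconnectedSpace S]
    {p : S} {e h : ℝ → S} (he : IsOpenEmbedding e) (hh : IsOpenEmbedding h)
    (hne : (range e ∩ range h).Nonempty) (hpe : p ∉ range e) (hph : p ∉ range h) :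
    ∃ g : ℝ → S, IsOpenEmbedding g ∧ range g = range e ∪ range h ∧ p ∉ range g := by
  have hp : p ∉ range e ∪ range h := fun H => H.elim hpe hph
  obtain ⟨g, hg, hr⟩ := exists_arc_union he hh hne fun hc => by
    have : IsClopen (range e ∪ range h) :=
      ⟨hc.isClosed, he.isOpen_range.union hh.isOpen_range⟩
    rw [this.eq_univ ⟨_, Or.inl (mem_range_self 0)⟩] at hp
    exact hp trivial
  exact ⟨g, hg, hr, hr ▸ hp⟩

/-- In a compact connected one-dimensional manifold, the connected sets that contain `x₀` and avoid
`p` lie in one open arc. -/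
lemma exists_arc_avoiding {S : Type*} [TopologicalSpace S] [T2Space S] [PreconnectedSpace S]
    [CompactSpace S] (hS : ∀ y : S, ∃ N ∈ 𝓝 y, Nonempty (N ≃ₜ ℝ)) {x₀ p : S} (hx : x₀ ≠ p) :
    ∃ g : ℝ → S, IsOpenEmbedding g ∧ p ∉ range g ∧
      ∀ D : Set S, IsPreconnected D → x₀ ∈ D → p ∉ D → D ⊆ range g := by
  -- A directed union of arcs need not be an arc (the long line is one), so compactness must yield a
  -- single arc that covers `M`.
  let ι := {g : ℝ → S // IsOpenEmbedding g ∧ x₀ ∈ range g ∧ p ∉ range g}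
  let M : Set S := ⋃ i : ι, range i.1
  have hMo : IsOpen M := isOpen_iUnion fun i => i.2.1.isOpen_range
  have hpM : p ∉ M := fun H => by
    obtain ⟨i, hi⟩ := mem_iUnion.1 H
    exact i.2.2.2 hi
  have hdir : Directed (· ⊆ ·) fun i : ι => range i.1 := by
    rintro ⟨e, he, hxe, hpe⟩ ⟨h, hh, hxh, hph⟩
    obtain ⟨g, hg, hr, hpg⟩ := exists_arc_union_avoiding he hh ⟨x₀, hxe, hxh⟩ hpe hph
    exact ⟨⟨g, hg, hr ▸ Or.inl hxe, hpg⟩, by simp [hr], by simp [hr]⟩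
  obtain ⟨e₀, he₀, hpe₀, hxe₀⟩ := exists_arc_subset (hS x₀) (isOpen_compl_singleton.mem_nhds hx)
  have hι : Nonempty ι := ⟨e₀, he₀, hxe₀, fun H => hpe₀ H rfl⟩
  have hxM : x₀ ∈ M := mem_iUnion.2 ⟨⟨e₀, he₀, hxe₀, fun H => hpe₀ H rfl⟩, hxe₀⟩
  have hMc : closure M ⊆ M ∪ {p} := by
    intro x hxcl
    by_cases hxp : x = p
    · exact Or.inr hxp
    obtain ⟨e, he, hpe, hxe⟩ := exists_arc_subset (hS x) (isOpen_compl_singleton.mem_nhds hxp)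
    obtain ⟨z, hze, hzM⟩ := mem_closure_iff.1 hxcl _ he.isOpen_range hxe
    obtain ⟨⟨h, hh, hxh, hph⟩, hzh⟩ := mem_iUnion.1 hzM
    obtain ⟨g, hg, hr, hpg⟩ := exists_arc_union_avoiding he hh ⟨z, hze, hzh⟩
      (fun H => hpe H rfl) hph
    exact Or.inl (mem_iUnion.2 ⟨⟨g, hg, hr ▸ Or.inr hxh, hpg⟩, hr.symm.subset (Or.inl hxe)⟩)
  have hMsub : ∀ D : Set S, IsPreconnected D → (D ∩ M).Nonempty → p ∉ D → D ⊆ M := by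
    intro D hD hne hpD
    refine hD.subset_of_closure_inter_subset hMo hne ?_
    rintro z ⟨hz, hzD⟩
    exact (hMc hz).resolve_right fun H => hpD (H ▸ hzD)
  obtain ⟨e, he, -, r, hr⟩ := exists_arc_subset (hS p) Filter.univ_mem
  -- extend an arc by one of the two halves of the arc `e` around `p`
  have hext : ∀ k : ℝ → ℝ, IsOpenEmbedding k → r ∉ range k → ∀ W : ι,
      (e (k 0) ∈ M → e (k 0) ∈ range W.1) →
      ∃ W' : ι, range W.1 ⊆ range W'.1 ∧ range (e ∘ k) ∩ M ⊆ range W'.1 := by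
    rintro k hk hrk ⟨w, hw, hxw, hpw⟩ hW
    have hpk : p ∉ range (e ∘ k) := by
      rintro ⟨t, ht⟩
      exact hrk ⟨t, he.injective (ht.trans hr.symm)⟩
    by_cases hne : (range (e ∘ k) ∩ M).Nonempty
    · have hsub := hMsub _ (isPreconnected_range (he.comp hk).continuous) hne hpk
      have h0 : e (k 0) ∈ range w := hW (hsub ⟨0, rfl⟩)
      obtain ⟨g, hg, hgr, hpg⟩ := exists_arc_union_avoiding hw (he.comp hk)
        ⟨_, h0, 0, rfl⟩ hpw hpk
      exact ⟨⟨g, hg, hgr ▸ Or.inl hxw, hpg⟩, by simp [hgr], by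
        rw [hgr]; exact inter_subset_left.trans subset_union_right⟩
    · exact ⟨⟨w, hw, hxw, hpw⟩, Subset.rfl, by rw [not_nonempty_iff_eq_empty.1 hne]; simp⟩
  let k₁ : ℝ → ℝ := fun t => r + Real.exp t
  let k₂ : ℝ → ℝ := fun t => r - Real.exp t
  have hk₁ : IsOpenEmbedding k₁ :=
    (Homeomorph.addLeft r).isOpenEmbedding.comp Real.isOpenEmbedding_exp
  have hk₂ : IsOpenEmbedding k₂ :=
    (Homeomorph.subLeft r).isOpenEmbedding.comp Real.isOpenEmbedding_exp
  have hr₁ : r ∉ range k₁ := fun ⟨t, ht⟩ => by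
    have := Real.exp_pos t
    simp only [k₁] at ht
    linarith
  have hr₂ : r ∉ range k₂ := fun ⟨t, ht⟩ => by
    have := Real.exp_pos t
    simp only [k₂] at ht
    linarith
  -- Outside the chart at `p`, one arc suffices. The base points of the two half-arcs at `p` are
  -- included so that each half lying in `M` meets this arc and can be attached to it.
  have hK : IsCompact ((closure M \ range e) ∪ ({e (k₁ 0), e (k₂ 0)} ∩ M)) :=
    (isClosed_closure.isCompact.diff he.isOpen_range).union
      (Set.Finite.isCompact ((toFinite _).inter_of_left _))
  obtain ⟨W, hW⟩ := hK.elim_directed_cover _ (fun i : ι => i.2.1.isOpen_range) (by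
    rintro z (⟨hz, hze⟩ | hz)
    · exact (hMc hz).resolve_right fun H => hze ⟨r, by rw [hr]; exact H.symm⟩
    · exact hz.2) hdir
  obtain ⟨W₁, h₁, h₁'⟩ := hext k₁ hk₁ hr₁ W fun H => hW (Or.inr ⟨by simp, H⟩)
  obtain ⟨W₂, h₂, h₂'⟩ := hext k₂ hk₂ hr₂ W₁ fun H => h₁ (hW (Or.inr ⟨by simp, H⟩))
  refine ⟨W₂.1, W₂.2.1, W₂.2.2.2, fun D hD hxD hpD z hz => ?_⟩
  have hzM : z ∈ M := hMsub D hD ⟨x₀, hxD, hxM⟩ hpD hz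
  by_cases hze : z ∈ range e
  · obtain ⟨t, rfl⟩ := hze
    rcases lt_trichotomy t r with ht | rfl | ht
    · exact h₂' ⟨⟨Real.log (r - t), by simp [k₂, Real.exp_log (sub_pos.2 ht)]⟩, hzM⟩
    · exact absurd (hr ▸ hzM) hpM
    · exact h₂ (h₁' ⟨⟨Real.log (t - r), by simp [k₁, Real.exp_log (sub_pos.2 ht)]⟩, hzM⟩)
  · exact h₂ (h₁ (hW (Or.inl ⟨subset_closure hzM, hze⟩)))

/-! ### Darboux injections into the line and into closed curves. -/

lemma IsDarboux.isPreconnected_image {X Y : Type*} [TopologicalSpace X] [TopologicalSpace Y]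
    {f : X → Y} (hf : IsDarboux f) {C : Set X} (hC : IsPreconnected C) :
    IsPreconnected (f '' C) := by
  rcases C.eq_empty_or_nonempty with rfl | hne
  · simpa using isPreconnected_empty
  · exact (hf C ⟨hne, hC⟩).isPreconnected

lemma IsDarboux.comp {X Y Z : Type*} [TopologicalSpace X] [TopologicalSpace Y] [TopologicalSpace Z]
    {f : X → Y} {g : Z → X} (hf : IsDarboux f) (hg : Continuous g) : IsDarboux (f ∘ g) := by
  intro C hC
  rw [image_comp]
  exact hf _ (hC.image g hg.continuousOn)

lemma IsDarboux.of_comp {X Y Z : Type*} [TopologicalSpace X] [TopologicalSpace Y]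
    [TopologicalSpace Z] {f : X → Y} {i : Y → Z} (hi : IsInducing i) (hf : IsDarboux (i ∘ f)) :
    IsDarboux f := by
  intro C hC
  have h := hf C hC
  rw [image_comp] at h
  exact ⟨hC.nonempty.image f, hi.isPreconnected_image.1 h.isPreconnected⟩

/-- Collapsing `V` to `a` retracts `D` continuously onto this set. -/
lemma isPreconnected_insert_of_disconnects {D : Type*} [TopologicalSpace D] [PreconnectedSpace D]
    {a : D} {U V : Set D} (hU : IsOpen U) (hV : IsOpen V) (hUV : Disjoint U V)
    (hcov : U ∪ V = {a}ᶜ) : IsPreconnected (insert a U) := by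
  classical
  have ha : a ∉ U ∧ a ∉ V := by
    rw [← not_or]
    exact fun H => (hcov ▸ H : a ∈ ({a}ᶜ : Set D)) rfl
  have hmem : ∀ x, x = a ∨ x ∈ U ∨ x ∈ V := fun x => by
    by_cases hx : x = a
    · exact Or.inl hx
    · exact Or.inr (hcov.symm ▸ hx : x ∈ U ∪ V)
  let r : D → D := fun x => if x ∈ V then a else x
  have hr : Continuous r := by
    refine Continuous.if (fun x hx => ?_) continuous_const continuous_id
    have hx' : x ∈ closure V \ interior V := hx
    rw [hV.interior_eq] at hx'
    rcases hmem x with h | h | h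
    · exact h.symm
    · exact absurd hx'.1 (hUV.closure_right hU |>.notMem_of_mem_left h)
    · exact absurd h hx'.2
  have : range r = insert a U := by
    apply Subset.antisymm
    · rintro _ ⟨x, rfl⟩
      by_cases hx : x ∈ V
      · simp [r, hx]
      · simp only [r, hx, if_false]
        exact (hmem x).imp_right fun H => H.resolve_right hx
    · rintro x (rfl | hx)
      · exact ⟨x, by simp [r]⟩
      · exact ⟨x, if_neg (hUV.notMem_of_mem_left hx)⟩
  exact this ▸ isPreconnected_range hr

lemma exists_open_of_not_isPreconnected {D : Type*} [TopologicalSpace D] {s : Set D} (hs : IsOpen s)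
    (h : ¬ IsPreconnected s) : ∃ U V : Set D, IsOpen U ∧ IsOpen V ∧ Disjoint U V ∧ U ∪ V = s ∧
      U.Nonempty ∧ V.Nonempty := by
  unfold IsPreconnected at h
  push Not at h
  obtain ⟨u, v, hu, hv, hsub, hsu, hsv, he⟩ := h
  refine ⟨s ∩ u, s ∩ v, hs.inter hu, hs.inter hv, ?_, ?_, hsu, hsv⟩
  · rw [disjoint_iff_inter_eq_empty, ← inter_inter_distrib_left, he]
  · rw [← inter_union_distrib_left, inter_eq_left.2 hsub]

/-- The case that matters is `c = g a` with `a` a cut point, `{a}ᶜ = U ∪ V`. The images of `insert a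
U` and `insert a V` are intervals that share only `g a`, so they lie on opposite sides of it and the
preimage is `U` or `V`. Otherwise it is empty, `{a}ᶜ` or everything. -/
lemma IsDarboux.isOpen_preimage_Iio {D : Type*} [TopologicalSpace D] [PreconnectedSpace D]
    [T1Space D] {g : D → ℝ} (hg : IsDarboux g) (hinj : Function.Injective g) (c : ℝ) :
    IsOpen (g ⁻¹' Iio c) := by
  -- the image of a connected set that avoids `c` lies on one side of `c`
  have hside : ∀ T : Set D, IsPreconnected T → (∀ t ∈ T, g t ≠ c) → ∀ u ∈ T, ∀ v ∈ T,
      g u < c → g v < c := by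
    intro T hT hne u hu v hv huc
    by_contra! hvc
    obtain ⟨t, ht, htc⟩ := (hg.isPreconnected_image hT).ordConnected.out ⟨u, hu, rfl⟩
      ⟨v, hv, rfl⟩ ⟨huc.le, hvc⟩
    exact hne t ht htc
  by_cases hc : c ∈ range g
  swap
  · rcases (g ⁻¹' Iio c).eq_empty_or_nonempty with he | ⟨u, hu⟩
    · rw [he]; exact isOpen_empty
    · convert isOpen_univ
      exact eq_univ_of_forall fun v =>
        hside univ isPreconnected_univ (fun t _ H => hc ⟨t, H⟩) u trivial v trivial hu
  obtain ⟨a, rfl⟩ := hc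
  have hne : ∀ t ∈ ({a}ᶜ : Set D), g t ≠ g a := fun t ht H => ht (hinj H)
  by_cases hpc : IsPreconnected ({a}ᶜ : Set D)
  · rcases (g ⁻¹' Iio (g a)).eq_empty_or_nonempty with he | ⟨u, hu⟩
    · rw [he]; exact isOpen_empty
    · convert isOpen_compl_singleton (x := a)
      ext v
      have hua : u ∈ ({a}ᶜ : Set D) := by rintro rfl; exact lt_irrefl (g _) hu
      refine ⟨?_, fun hv => hside _ hpc hne u hua v hv hu⟩
      rintro hv rfl
      exact lt_irrefl (g _) hv
  obtain ⟨U, V, hU, hV, hUV, hcov, ⟨u₀, hu₀⟩, ⟨v₀, hv₀⟩⟩ :=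
    exists_open_of_not_isPreconnected isOpen_compl_singleton hpc
  have key : ∀ U V : Set D, IsOpen U → IsOpen V → Disjoint U V → U ∪ V = {a}ᶜ → ∀ u ∈ U, ∀ v ∈ V,
      (g u ≤ g v → g a ≤ g v) ∧ (g v ≤ g u → g v ≤ g a) := by
    intro U V hU hV hUV hcov u hu v hv
    have hC := (hg.isPreconnected_image
      (isPreconnected_insert_of_disconnects hU hV hUV hcov)).ordConnected
    have hv' : g v ∉ g '' insert a U := by
      rintro ⟨w, hw, hwv⟩
      rw [hinj hwv] at hw
      rcases hw with rfl | hw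
      · exact (hcov ▸ Or.inr hv : v ∈ ({v}ᶜ : Set D)) rfl
      · exact hUV.notMem_of_mem_left hw hv
    refine ⟨fun h => ?_, fun h => ?_⟩ <;> by_contra! h'
    · exact hv' (hC.out ⟨u, Or.inr hu, rfl⟩ ⟨a, Or.inl rfl, rfl⟩ ⟨h, h'.le⟩)
    · exact hv' (hC.out ⟨a, Or.inl rfl, rfl⟩ ⟨u, Or.inr hu, rfl⟩ ⟨h'.le, h⟩)
  have hopp : ∀ u ∈ U, ∀ v ∈ V, g u < g a ↔ g a < g v := by
    intro u hu v hv
    have hua := hne u (hcov ▸ Or.inl hu)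
    have hva := hne v (hcov ▸ Or.inr hv)
    have h₁ := key U V hU hV hUV hcov u hu v hv
    have h₂ := key V U hV hU hUV.symm (union_comm U V ▸ hcov) v hv u hu
    rcases le_total (g u) (g v) with h | h
    · exact ⟨fun _ => lt_of_le_of_ne (h₁.1 h) hva.symm, fun _ => lt_of_le_of_ne (h₂.2 h) hua⟩
    · have := h₁.2 h
      have := h₂.1 h
      constructor <;> intro <;> linarith
  have hcase : ∀ x, x = a ∨ x ∈ U ∨ x ∈ V := fun x => by
    by_cases hx : x = a
    · exact Or.inl hx
    · exact Or.inr (hcov.symm ▸ hx : x ∈ U ∪ V)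
  rcases lt_or_ge (g u₀) (g a) with h | h
  · convert hU
    ext x
    have hv := (hopp u₀ hu₀ v₀ hv₀).1 h
    rcases hcase x with rfl | hx | hx
    · exact iff_of_false (lt_irrefl (g x)) fun H => hne x (hcov ▸ Or.inl H) rfl
    · exact iff_of_true ((hopp x hx v₀ hv₀).2 hv) hx
    · exact iff_of_false (not_lt.2 ((hopp u₀ hu₀ x hx).1 h).le) (hUV.notMem_of_mem_right hx)
  · convert hV
    ext x
    have hv : ¬ g a < g v₀ := fun H => not_lt.2 h ((hopp u₀ hu₀ v₀ hv₀).2 H)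
    rcases hcase x with rfl | hx | hx
    · exact iff_of_false (lt_irrefl (g x)) fun H => hne x (hcov ▸ Or.inr H) rfl
    · exact iff_of_false (fun H => hv ((hopp x hx v₀ hv₀).1 H)) (hUV.notMem_of_mem_left hx)
    · refine iff_of_true (lt_of_le_of_ne (not_lt.1 fun H => ?_) (hne x (hcov ▸ Or.inr hx))) hx
      exact not_lt.2 h ((hopp u₀ hu₀ x hx).2 H)

/-- A Darboux injection of a connected space into the line is continuous. -/
lemma IsDarboux.continuous_real {D : Type*} [TopologicalSpace D] [PreconnectedSpace D]
    [T1Space D] {g : D → ℝ} (hg : IsDarboux g) (hinj : Function.Injective g) : Continuous g := by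
  rw [OrderTopology.topology_eq_generate_intervals (α := ℝ), continuous_generateFrom_iff]
  rintro _ ⟨c, rfl | rfl⟩
  · have hn : IsDarboux fun x => -g x := fun C hC => by
      have := (hg C hC).image _ continuous_neg.continuousOn
      rwa [image_image] at this
    have := hn.isOpen_preimage_Iio (neg_injective.comp hinj) (-c)
    simpa [preimage, Iio, Ioi] using this
  · exact hg.isOpen_preimage_Iio hinj c

/-- A Darboux injection that is not onto factors through the line. -/
lemma IsDarboux.exists_factor {D S : Type*} [TopologicalSpace D] [ConnectedSpace D] [T1Space D]
    [TopologicalSpace S] [T2Space S] [PreconnectedSpace S] [CompactSpace S]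
    (hS : ∀ y : S, ∃ N ∈ 𝓝 y, Nonempty (N ≃ₜ ℝ)) {g : D → S} (hg : IsDarboux g)
    (hinj : Function.Injective g) (hsurj : ¬ Function.Surjective g) :
    ∃ (k : D → ℝ) (e : ℝ → S), Continuous k ∧ Function.Injective k ∧ IsOpenEmbedding e ∧
      g = e ∘ k := by
  obtain ⟨p, hp⟩ := not_forall.1 hsurj
  obtain ⟨d₀⟩ := (inferInstance : Nonempty D)
  obtain ⟨e, he, -, hsub⟩ := exists_arc_avoiding hS (x₀ := g d₀) (p := p) fun H => hp ⟨d₀, H⟩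
  have hr := hsub (range g) (image_univ ▸ hg.isPreconnected_image isPreconnected_univ)
    (mem_range_self _) hp
  choose k hk using fun d => hr (mem_range_self d)
  have hgk : g = e ∘ k := funext fun d => (hk d).symm
  have hki : Function.Injective k := Function.Injective.of_comp (f := e) (hgk ▸ hinj)
  have hkD : IsDarboux k := IsDarboux.of_comp he.isInducing (hgk ▸ hg)
  exact ⟨k, e, hkD.continuous_real hki, hki, he, hgk⟩

lemma IsDarboux.continuousOn_of_isConnected {D S : Type*} [TopologicalSpace D] [T1Space D]
    [TopologicalSpace S] [T2Space S] [PreconnectedSpace S] [CompactSpace S]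
    (hS : ∀ y : S, ∃ N ∈ 𝓝 y, Nonempty (N ≃ₜ ℝ)) {g : D → S} (hg : IsDarboux g)
    (hinj : Function.Injective g) {T : Set D} (hT : IsConnected T) (hne : g '' T ≠ univ) :
    ContinuousOn g T := by
  have : ConnectedSpace T := isConnected_iff_connectedSpace.1 hT
  rw [continuousOn_iff_continuous_domRestrict]
  obtain ⟨k, e, hk, -, he, h⟩ := IsDarboux.exists_factor hS (g := g ∘ ((↑) : T → D))
    (hg.comp continuous_subtype_val) (hinj.comp Subtype.val_injective) fun H => hne (by
      rw [← H.range_eq, range_comp, Subtype.range_coe])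
  exact (h ▸ he.continuous.comp hk : Continuous (g ∘ ((↑) : T → D)))

/-- If `a` cut `D` into `U` and `V`, then `g` would be continuous on the compact sets `insert a U`
and `insert a V`, whose images are proper. So `g '' U` is open, being the complement of `g '' insert
a V`. Inside an arc, the compact set `g '' insert a U` then has no extreme point but `g a`, so it is
a single point. -/
lemma IsDarboux.isPreconnected_compl_singleton {D S : Type*} [TopologicalSpace D]
    [PreconnectedSpace D] [T2Space D] [CompactSpace D] [TopologicalSpace S] [T2Space S]
    [PreconnectedSpace S] [CompactSpace S]
    (hS : ∀ y : S, ∃ N ∈ 𝓝 y, Nonempty (N ≃ₜ ℝ)) {g : D → S} (hg : IsDarboux g)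
    (hbij : Function.Bijective g) (a : D) : IsPreconnected ({a}ᶜ : Set D) := by
  by_contra hpc
  obtain ⟨U, V, hU, hV, hUV, hcov, ⟨u₀, hu₀⟩, ⟨v₀, hv₀⟩⟩ :=
    exists_open_of_not_isPreconnected isOpen_compl_singleton hpc
  have hcase : ∀ x, x = a ∨ x ∈ U ∨ x ∈ V := fun x => by
    by_cases hx : x = a
    · exact Or.inl hx
    · exact Or.inr (hcov.symm ▸ hx : x ∈ U ∪ V)
  have haU : a ∉ U := fun H => (hcov ▸ Or.inl H : a ∈ ({a}ᶜ : Set D)) rfl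
  have haV : a ∉ V := fun H => (hcov ▸ Or.inr H : a ∈ ({a}ᶜ : Set D)) rfl
  have himg : ∀ U V : Set D, IsOpen U → IsOpen V → Disjoint U V → U ∪ V = {a}ᶜ → V.Nonempty →
      a ∉ V → IsConnected (insert a U) ∧ g '' insert a U ≠ univ ∧ IsCompact (g '' insert a U) := by
    intro U V hU hV hUV hcov ⟨v, hv⟩ haV
    have hc : IsConnected (insert a U) := ⟨⟨a, Or.inl rfl⟩,
      isPreconnected_insert_of_disconnects hU hV hUV hcov⟩
    have hne : g '' insert a U ≠ univ := fun H => by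
      obtain ⟨w, hw, hwv⟩ := (H ▸ mem_univ (g v) : g v ∈ g '' insert a U)
      rw [hbij.1 hwv] at hw
      rcases hw with rfl | hw
      · exact haV hv
      · exact hUV.notMem_of_mem_left hw hv
    have heq : insert a U = Vᶜ := by
      ext x
      constructor
      · rintro (rfl | hx)
        · exact haV
        · exact hUV.notMem_of_mem_left hx
      · intro hx
        by_cases hxa : x = a
        · exact Or.inl hxa
        · exact Or.inr ((hcov.symm ▸ hxa : x ∈ U ∪ V).resolve_right hx)
    exact ⟨hc, hne, (heq ▸ hV.isClosed_compl.isCompact).image_of_continuousOn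
      (hg.continuousOn_of_isConnected hS hbij.1 hc hne)⟩
  obtain ⟨hc₁, hn₁, hk₁⟩ := himg U V hU hV hUV hcov ⟨v₀, hv₀⟩ haV
  obtain ⟨-, -, hk₂⟩ := himg V U hV hU hUV.symm (union_comm U V ▸ hcov) ⟨u₀, hu₀⟩ haU
  -- the complement of `g '' insert a V` is open and equal to `g '' U`
  have hO : (g '' insert a V)ᶜ = g '' U := by
    rw [← image_compl_eq hbij]
    congr 1
    ext x
    constructor
    · intro hx
      rw [mem_compl_iff, mem_insert_iff, not_or] at hx
      rcases hcase x with h | h | h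
      · exact absurd h hx.1
      · exact h
      · exact absurd h hx.2
    · rintro hx (rfl | hx')
      · exact haU hx
      · exact hUV.notMem_of_mem_left hx hx'
  have hOo : IsOpen (g '' U) := hO ▸ hk₂.isClosed.isOpen_compl
  obtain ⟨p, hp⟩ := (ne_univ_iff_exists_notMem _).1 hn₁
  obtain ⟨e, he, -, hsub⟩ := exists_arc_avoiding hS (x₀ := g a) (p := p)
    fun H => hp ⟨a, Or.inl rfl, H⟩
  have hsub := hsub _ (hg.isPreconnected_image hc₁.isPreconnected) ⟨a, Or.inl rfl, rfl⟩ hp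
  have hKc : IsCompact (e ⁻¹' (g '' insert a U)) := he.isInducing.isCompact_preimage' hk₁ hsub
  obtain ⟨α, hα⟩ := hsub ⟨a, Or.inl rfl, rfl⟩
  obtain ⟨β, hβ⟩ := hsub ⟨u₀, Or.inr hu₀, rfl⟩
  have hne : (e ⁻¹' (g '' insert a U)).Nonempty := ⟨α, a, Or.inl rfl, hα.symm⟩
  obtain ⟨m, hm, hm'⟩ := hKc.exists_isLeast hne
  obtain ⟨M, hM, hM'⟩ := hKc.exists_isGreatest hne
  have hTo : IsOpen (e ⁻¹' (g '' U)) := hOo.preimage he.continuous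
  have hTK : e ⁻¹' (g '' U) ⊆ e ⁻¹' (g '' insert a U) :=
    preimage_mono (image_mono (subset_insert _ _))
  have hext : ∀ x ∈ e ⁻¹' (g '' insert a U), x ∉ e ⁻¹' (g '' U) → x = α := by
    rintro x ⟨w, hw, hwx⟩ hx
    rcases hw with rfl | hw
    · exact he.injective (hwx.symm.trans hα.symm)
    · exact absurd ⟨w, hw, hwx⟩ hx
  have hmα : m = α := hext m hm fun H => by
    obtain ⟨ε, hε, hs⟩ := Metric.isOpen_iff.1 hTo m H
    have := hm' (hTK (hs (show m - ε / 2 ∈ Metric.ball m ε by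
      rw [Metric.mem_ball, Real.dist_eq, abs_lt]; constructor <;> linarith)))
    linarith
  have hMα : M = α := hext M hM fun H => by
    obtain ⟨ε, hε, hs⟩ := Metric.isOpen_iff.1 hTo M H
    have := hM' (hTK (hs (show M + ε / 2 ∈ Metric.ball M ε by
      rw [Metric.mem_ball, Real.dist_eq, abs_lt]; constructor <;> linarith)))
    linarith
  have hβK : β ∈ e ⁻¹' (g '' insert a U) := ⟨u₀, Or.inr hu₀, hβ.symm⟩
  have hβα : β = α := le_antisymm (hMα ▸ hM' hβK) (hmα ▸ hm' hβK)
  have : u₀ = a := hbij.1 (by rw [← hα, ← hβ, hβα])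
  exact haU (this ▸ hu₀)

/-- A Darboux bijection of a continuum onto a compact connected one-dimensional manifold is
continuous. -/
lemma IsDarboux.continuous_of_bijective {D S : Type*} [TopologicalSpace D] [PreconnectedSpace D]
    [T2Space D] [CompactSpace D] [TopologicalSpace S] [T2Space S] [PreconnectedSpace S]
    [CompactSpace S] (hS : ∀ y : S, ∃ N ∈ 𝓝 y, Nonempty (N ≃ₜ ℝ)) {g : D → S} (hg : IsDarboux g)
    (hbij : Function.Bijective g) : Continuous g := by
  rcases subsingleton_or_nontrivial D with h | h
  · exact continuous_of_const fun x y => by rw [Subsingleton.elim x y]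
  rw [continuous_iff_continuousAt]
  intro x
  obtain ⟨a, ha⟩ := exists_ne x
  have hconn : IsConnected ({a}ᶜ : Set D) :=
    ⟨⟨x, ha.symm⟩, hg.isPreconnected_compl_singleton hS hbij a⟩
  refine (hg.continuousOn_of_isConnected hS hbij.1 hconn fun H => ?_).continuousAt
    (isOpen_compl_singleton.mem_nhds ha.symm)
  obtain ⟨w, hw, hwa⟩ := (H ▸ mem_univ (g a) : g a ∈ g '' {a}ᶜ)
  exact hw (hbij.1 hwa)

/-- A continuum with a Darboux injection into, but not onto, a compact connected one-dimensional
manifold is a segment. -/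
lemma IsDarboux.exists_homeomorph_Icc {D S : Type*} [TopologicalSpace D] [ConnectedSpace D]
    [T2Space D] [CompactSpace D] [TopologicalSpace S] [T2Space S] [PreconnectedSpace S]
    [CompactSpace S] (hS : ∀ y : S, ∃ N ∈ 𝓝 y, Nonempty (N ≃ₜ ℝ)) {g : D → S} (hg : IsDarboux g)
    (hinj : Function.Injective g) (hsurj : ¬ Function.Surjective g) :
    ∃ a b : ℝ, a ≤ b ∧ Nonempty (D ≃ₜ Icc a b) := by
  obtain ⟨k, -, hk, hki, -, -⟩ := hg.exists_factor hS hinj hsurj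
  have hr : range k = Icc (sInf (range k)) (sSup (range k)) :=
    eq_Icc_of_connected_compact (isConnected_range hk) (isCompact_range hk)
  refine ⟨_, _, ?_, ⟨(hk.isClosedEmbedding hki).isEmbedding.toHomeomorph.trans
    (Homeomorph.setCongr hr)⟩⟩
  rw [← nonempty_Icc, ← hr]
  exact range_nonempty k

/-! ### Fences and preimages of separating curves. -/

/-- A closed set that is mapped by a Darboux injection into a
compact connected one-dimensional manifold is a fence, unless it contains a continuum that is
mapped continuously onto this manifold. -/
lemma IsDarboux.isFence {X Y : Type*} [TopologicalSpace X] [TopologicalSpace Y] [CompactSpace X]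
    [T2Space X] [T2Space Y] {f : X → Y} (hf : IsDarboux f) (hinj : Function.Injective f) {S : Set Y}
    (hSc : IsCompact S) (hSconn : IsConnected S) (hS : ∀ y : S, ∃ N ∈ 𝓝 y, Nonempty (N ≃ₜ ℝ))
    (hK : ∀ K : Set X, IsCompact K → ContinuousOn f K → f '' K ≠ S) {F : Set X} (hF : IsClosed F)
    (hFS : F ⊆ f ⁻¹' S) : IsFence F := by
  have hFc : CompactSpace F := isCompact_iff_compactSpace.1 hF.isCompact
  have : CompactSpace S := isCompact_iff_compactSpace.1 hSc
  have : ConnectedSpace S := isConnected_iff_connectedSpace.1 hSconn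
  refine ⟨hFc, inferInstance, fun x => ?_⟩
  have : CompactSpace (connectedComponent x) :=
    isCompact_iff_compactSpace.1 isClosed_connectedComponent.isCompact
  have : ConnectedSpace (connectedComponent x) :=
    isConnected_iff_connectedSpace.1 isConnected_connectedComponent
  let i : connectedComponent x → X := fun z => z.1.1
  have hi : Continuous i := continuous_subtype_val.comp continuous_subtype_val
  have hii : Function.Injective i := Subtype.val_injective.comp Subtype.val_injective
  let g : connectedComponent x → S := fun z => ⟨f (i z), hFS z.1.2⟩
  have hg : IsDarboux g := IsDarboux.of_comp (i := ((↑) : S → Y)) IsInducing.subtypeVal (hf.comp hi)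
  have hgi : Function.Injective g := fun z w h => hii (hinj (congrArg Subtype.val h))
  refine hg.exists_homeomorph_Icc hS hgi fun hsurj => ?_
  have hgc : Continuous g := hg.continuous_of_bijective hS ⟨hgi, hsurj⟩
  refine hK (range i) (isCompact_range hi) ?_ ?_
  · have hie : IsEmbedding i := (hi.isClosedEmbedding hii).isEmbedding
    rw [← image_univ, hie.isInducing.continuousOn_image_iff, continuousOn_univ]
    exact continuous_subtype_val.comp hgc
  · rw [← range_comp]
    have : f ∘ i = ((↑) : S → Y) ∘ g := rfl
    rw [this, range_comp, hsurj.range_eq, image_univ, Subtype.range_coe]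

/-- Without `K`, no closed subset of `A = f ⁻¹' S` separates `X`. But `Aᶜ` is disconnected, since
its image `range f \ S` is, and it is dense. The closures of its two parts cover `X` and meet in a
closed subset of `A`, which separates `X`. -/
lemma IsDarboux.exists_continuousOn_image_eq {X Y : Type*} [TopologicalSpace X] [TopologicalSpace Y]
    [CompactSpace X] [T2Space X] [T2Space Y] (hX : ∀ F : Set X, IsFence F → ¬ Separates F univ)
    {f : X → Y} (hf : IsDarboux f) (hinj : Function.Injective f) {S : Set Y}
    (hSc : IsCompact S) (hSconn : IsConnected S) (hS : ∀ y : S, ∃ N ∈ 𝓝 y, Nonempty (N ≃ₜ ℝ))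
    (hsep : Separates S (range f)) :
    ∃ K : Set X, IsCompact K ∧ ContinuousOn f K ∧ f '' K = S := by
  by_contra! hK
  have hconn : ∀ F : Set X, IsClosed F → F ⊆ f ⁻¹' S → IsPreconnected Fᶜ := by
    intro F hF hFS
    have := hX F (hf.isFence hinj hSc hSconn hS hK hF hFS)
    rwa [Separates, not_not, ← compl_eq_univ_sdiff] at this
  set A := f ⁻¹' S with hA
  have himg : f '' Aᶜ = range f \ S := by
    ext y
    constructor
    · rintro ⟨x, hx, rfl⟩
      exact ⟨mem_range_self x, hx⟩
    · rintro ⟨⟨x, rfl⟩, hx⟩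
      exact ⟨x, hx, rfl⟩
  have hnp : ¬ IsPreconnected Aᶜ := fun H => hsep (himg ▸ hf.isPreconnected_image H)
  have hne : Aᶜ.Nonempty := nonempty_iff_ne_empty.2 fun H => hnp (H ▸ isPreconnected_empty)
  -- Otherwise the frontier of a small open set with closure in `A` would separate that set from the
  -- points outside `A`.
  have hint : interior A = ∅ := by
    rw [← not_nonempty_iff_eq_empty]
    rintro ⟨x, hx⟩
    obtain ⟨O, hO, hxO, hOA⟩ : ∃ O : Set X, IsOpen O ∧ x ∈ O ∧ closure O ⊆ A := by
      obtain ⟨N, hN, hNc, hNA⟩ := exists_mem_nhds_isClosed_subset (mem_interior_iff_mem_nhds.1 hx)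
      exact ⟨interior N, isOpen_interior, mem_interior_iff_mem_nhds.2 hN,
        (closure_minimal interior_subset hNc).trans hNA⟩
    obtain ⟨z, hz⟩ := hne
    have hzO : z ∉ closure O := fun H => hz (hOA H)
    have hfr : frontier O = closure O \ O := hO.frontier_eq
    obtain ⟨w, -, hw, hw'⟩ := hconn (frontier O) isClosed_frontier (frontier_subset_closure.trans hOA)
      O (closure O)ᶜ hO isClosed_closure.isOpen_compl
      (by
        intro w hw
        rw [hfr] at hw
        by_cases h : w ∈ closure O
        · exact Or.inl (by_contra fun h' => hw ⟨h, h'⟩)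
        · exact Or.inr h)
      ⟨x, fun H => (hfr ▸ H).2 hxO, hxO⟩ ⟨z, fun H => hzO (frontier_subset_closure H), hzO⟩
    exact hw' (subset_closure hw)
  unfold IsPreconnected at hnp
  push Not at hnp
  obtain ⟨u, v, hu, hv, hcov, hAu, hAv, he⟩ := hnp
  have hdisj : ∀ u v : Set X, IsOpen u → Aᶜ ∩ (u ∩ v) = ∅ → ∀ z ∉ A, z ∈ u →
      z ∉ closure (Aᶜ ∩ v) := by
    intro u v hu he z hz hzu hzv
    have hux : u ∩ Aᶜ ∩ v = ∅ := by rw [← he]; ext; simp only [mem_inter_iff]; tauto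
    obtain ⟨w, hwu, hwA, hwv⟩ := mem_closure_iff.1 hzv u hu hzu
    exact (hux.subset ⟨⟨hwu, hwA⟩, hwv⟩)
  have hF : closure (Aᶜ ∩ u) ∩ closure (Aᶜ ∩ v) ⊆ A := by
    rintro z ⟨hzu, hzv⟩
    by_contra hz
    rcases hcov hz with h | h
    · exact hdisj u v hu he z hz h hzv
    · exact hdisj v u hv (inter_comm u v ▸ he) z hz h hzu
  have hpc := hconn _ (isClosed_closure.inter isClosed_closure) hF
  rw [isPreconnected_closed_iff] at hpc
  obtain ⟨w, hw, hw'⟩ := hpc _ _ isClosed_closure isClosed_closure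
    (by
      rw [← closure_union, ← inter_union_distrib_left, inter_eq_left.2 hcov, closure_compl, hint,
        compl_empty]
      exact subset_univ _)
    (hAu.imp fun z hz => ⟨fun H => hz.1 (hF H), subset_closure hz⟩)
    (hAv.imp fun z hz => ⟨fun H => hz.1 (hF H), subset_closure hz⟩)
  exact hw hw'

/-! ### Continuity into componnected spaces. -/

/-- For `x ∈ closure C` the set `insert x C` is connected, so `f x` cannot be isolated in its image.
-/
lemma IsDarboux.image_closure_subset {X Y : Type*} [TopologicalSpace X] [TopologicalSpace Y]
    [T1Space Y] {f : X → Y} (hf : IsDarboux f) {C : Set X} (hC : IsConnected C) :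
    f '' closure C ⊆ closure (f '' C) := by
  rintro _ ⟨x, hx, rfl⟩
  by_contra hcl
  have hp := (hf _ (hC.subset_closure (subset_insert x C)
    (insert_subset hx subset_closure))).isPreconnected
  obtain ⟨c, hc⟩ := hC.nonempty
  obtain ⟨_, ⟨w, hw, rfl⟩, h₁, h₂⟩ := hp (closure (f '' C))ᶜ {f x}ᶜ
    isClosed_closure.isOpen_compl isOpen_compl_singleton
    (by
      intro y _
      by_cases hy : y = f x
      · exact Or.inl (hy ▸ hcl)
      · exact Or.inr hy)
    ⟨f x, ⟨x, Or.inl rfl, rfl⟩, hcl⟩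
    ⟨f c, ⟨c, Or.inr hc, rfl⟩, fun H => hcl (subset_closure ⟨c, hc, H⟩)⟩
  rcases hw with rfl | hw
  · exact h₂ rfl
  · exact h₁ (subset_closure ⟨w, hw, rfl⟩)

/-- A Darboux closed bijection of a compact space onto a componnected space is continuous. -/
lemma IsDarboux.continuous_of_isClosedMap {X Z : Type*} [TopologicalSpace X] [TopologicalSpace Z]
    [T2Space X] [T1Space Z] (hZ : IsComponnected Z) {f : X → Z} (hf : IsDarboux f)
    (hbij : Function.Bijective f) (hcl : IsClosedMap f) : Continuous f := by
  obtain ⟨B, hB, hBc⟩ := hZ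
  let φ := Equiv.ofBijective f hbij
  have hφ : Continuous φ.symm := by
    rw [continuous_iff_isClosed]
    intro T hT
    have : φ.symm ⁻¹' T = f '' T := (φ.image_eq_preimage_symm T).symm
    exact this ▸ hcl T hT
  have hpre : ∀ C : Set Z, f ⁻¹' C = φ.symm '' C := fun C => (φ.symm.image_eq_preimage_symm C).symm
  refine hB.continuous_iff.2 fun U hU => ?_
  obtain ⟨F, hF, hFc, hUF⟩ := hBc U hU
  -- The pieces need not be closed; it is enough that the closure of each preimage stays in the
  -- preimage of `Uᶜ`. The inverse of `f` is continuous, so these preimages are compact or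
  -- connected.
  rw [← isClosed_compl_iff, ← preimage_compl, ← closure_subset_iff_isClosed, hUF, sUnion_eq_biUnion,
    preimage_iUnion₂, hF.closure_biUnion]
  refine iUnion₂_subset fun C hC => ?_
  rw [← preimage_iUnion₂, ← sUnion_eq_biUnion, ← hUF]
  have hCU : C ⊆ Uᶜ := hUF ▸ subset_sUnion_of_mem hC
  rcases hFc C hC with hc | hc
  · have : IsClosed (f ⁻¹' C) := by
      rw [hpre]
      exact (hc.image hφ).isClosed
    rw [this.closure_eq]
    exact preimage_mono hCU
  · have hc' : IsConnected (f ⁻¹' C) := by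
      rw [hpre]
      exact hc.image _ hφ.continuousOn
    intro x hx
    have := hf.image_closure_subset hc' ⟨x, hx, rfl⟩
    rw [image_preimage_eq _ hbij.2] at this
    exact closure_minimal hCU (hB.isOpen hU).isClosed_compl this

/-! ### The main theorem. -/

theorem theorem5p1 {X Y : Type*} [TopologicalSpace X] [TopologicalSpace Y]
    [CompactSpace X] [T2Space X] [Nontrivial X]
    (hX : ∀ F : Set X, IsFence F → ¬ Separates F Set.univ)
    (hY : IsVariety 2 Y)
    (f : X → Y) (hf : IsDarboux f) (hinj : Function.Injective f) :
    Topology.IsOpenEmbedding f := by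
  obtain ⟨hT2, hfc, hcomp, hvar⟩ := hY
  have hXc : IsConnected (univ : Set X) := by
    refine ⟨univ_nonempty, ?_⟩
    -- The empty fence does not separate `X`, so `X` is connected.
    have := hX ∅ ⟨isCompact_iff_compactSpace.1 isCompact_empty, inferInstance, fun x => x.2.elim⟩
    rwa [Separates, not_not, sdiff_empty] at this
  have hrc : IsConnected (range f) := image_univ ▸ hf _ hXc
  have hnt : (range f).Nontrivial := by
    obtain ⟨a, b, hab⟩ := exists_pair_ne X
    exact ⟨f a, ⟨a, rfl⟩, f b, ⟨b, rfl⟩, fun H => hab (hinj H)⟩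
  have key : ∀ (s : ℕ → Y) (y : Y), Filter.Tendsto s Filter.atTop (𝓝 y) → y ∈ closure (range f) →
      ∃ K : Set X, IsCompact K ∧ ContinuousOn f K ∧ {k : ℕ | s k ∈ f '' K}.Infinite := by
    intro s y hs hy
    obtain ⟨S, hSc, hSconn, ⟨-, hS⟩, hsep, hinf⟩ := hvar _ hrc hnt s y hs hy
    obtain ⟨K, hK, hKf, rfl⟩ :=
      hf.exists_continuousOn_image_eq hX hinj hSc hSconn hS hsep
    exact ⟨K, hK, hKf, hinf⟩
  have hclosed : IsClosed (range f) := by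
    refine isClosed_of_closure_subset fun y hy => ?_
    -- A constant sequence forces the limit point itself onto a curve inside `range f`.
    obtain ⟨K, -, -, hinf⟩ := key (fun _ => y) y tendsto_const_nhds hy
    obtain ⟨k, hk⟩ := hinf.nonempty
    exact image_subset_range _ _ hk
  have hopen : IsOpen (range f) := by
    rw [← isClosed_compl_iff]
    refine isClosed_of_closure_subset fun y hy hyf => ?_
    obtain ⟨s, hs, hsy⟩ := mem_closure_iff_seq_limit.1 hy
    obtain ⟨K, -, -, hinf⟩ := key s y hsy (subset_closure hyf)
    obtain ⟨k, hk⟩ := hinf.nonempty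
    exact hs k (image_subset_range _ _ hk)
  have hfcl : IsClosedMap f := by
    intro T hT
    refine isClosed_of_closure_subset fun y hy => ?_
    obtain ⟨s, hs, hsy⟩ := mem_closure_iff_seq_limit.1 hy
    obtain ⟨K, hK, hKf, hinf⟩ := key s y hsy (closure_mono (image_subset_range _ _) hy)
    -- Infinitely many `s k` lie in this compact set, so their limit does too.
    have hKT : IsClosed (f '' (K ∩ T)) :=
      ((hK.inter_right hT).image_of_continuousOn (hKf.mono inter_subset_left)).isClosed
    refine image_mono inter_subset_right (hKT.mem_of_frequently_of_tendsto ?_ hsy)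
    rw [Nat.frequently_atTop_iff_infinite]
    convert hinf using 3 with k
    rw [image_inter hinj]
    exact and_iff_left (hs k)
  obtain ⟨x₀⟩ := (inferInstance : Nonempty X)
  have hcc : range f = connectedComponent (f x₀) :=
    Subset.antisymm (hrc.isPreconnected.subset_connectedComponent ⟨x₀, rfl⟩)
      (IsClopen.connectedComponent_subset ⟨hclosed, hopen⟩ ⟨x₀, rfl⟩)
  let f₀ : X → connectedComponent (f x₀) := fun x => ⟨f x, hcc ▸ mem_range_self x⟩
  have hf₀ : Continuous f₀ := by
    refine IsDarboux.continuous_of_isClosedMap (hcomp _)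
      (IsDarboux.of_comp (i := ((↑) : connectedComponent (f x₀) → Y)) IsInducing.subtypeVal hf)
      ⟨fun a b h => hinj (congrArg Subtype.val h), ?_⟩ ?_
    · rintro ⟨y, hy⟩
      obtain ⟨x, rfl⟩ := hcc.symm ▸ hy
      exact ⟨x, rfl⟩
    · intro T hT
      rw [IsInducing.subtypeVal.isClosed_iff]
      refine ⟨f '' T, hfcl T hT, ?_⟩
      ext y
      simp [f₀, Subtype.ext_iff]
  have hfcont : Continuous f := continuous_subtype_val.comp hf₀
  exact ⟨(hfcont.isClosedEmbedding hinj).isEmbedding, hopen⟩
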